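/- Let $(Z,A)$ be a random vector with values in $\{0,1\}\times\{0,1\}$, with $P(Z=1,A=1)>0$ and $P(Z\neq A)>0$, and let $(Z_1,A_1),(Z_2,A_2),\dots$ be independent and identically distributed copies of $(Z,A)$. Write $E$ for the expectation and $E_nf(Z,A)=n^{-1}\sum_{i=1}^n f(Z_i,A_i)$ for the sample average. For $a,b>0$ let $$\tau(a,b)=\frac{E(ZA)}{E(ZA)+aE(A(1-Z))+bE(Z(1-A))},\qquad \nu(a,b)=\frac{\tau(a^2,b^2)^{-1}-1+\{\tau(a,b)^{-1}-1\}^2}{E(ZA)\,\tau(a,b)^{-4}}$$ be the Tversky index and its asymptotic variance, and let $\tau_n(a,b)$, $\nu_n(a,b)$ be given by the same formulas with $E_n$ in place of $E$ (with any fixed convention, such as $x/0=0$, on the event $E_n(ZA)=0$, whose probability tends to $0$). Let $\Phi$ be the standard normal distribution function and $\Phi^{-1}$ its quantile function, and let $x\pm h$ denote the interval $[x-h,x+h]$. Then for all $a,b>0$ and every $\alpha\in(0,1)$, $$\lim_{n\to\infty}P\Big[\tau(a,b)\in\tau_n(a,b)\pm\Phi^{-1}\big(1-\tfrac{\alpha}{2}\big)\sqrt{\nu_n(a,b)/n}\Big]=1-\alpha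 .$$ For $\alpha=0.05$ one has $\Phi^{-1}(1-\alpha/2)\approx1.96$ (with error less than $0.005$), and $\tau_n(a,b)\pm1.96\sqrt{\nu_n(a,b)/n}$ is an approximate $95\%$ confidence interval for $\tau(a,b)$: as $n\to\infty$, its coverage probability tends to $P(|N|\le 1.96)$ with $N$ standard normal, which differs from $0.95$ by less than $0.0005$. The same statements hold, for every $\beta>0$, for the F measure $$\phi_\beta=\frac{1+\beta^2}{1/\mathrm{prec}+\beta^2/\mathrm{rec}},\qquad \mathrm{prec}=\frac{E(ZA)}{E(A)},\quad \mathrm{rec}=\frac{E(ZA)}{E(Z)},$$ in place of $\tau(a,b)$, with its sample version (with $E_n$ for $E$) in place of $\tau_n(a,b)$, and with $\nu_n\big(\tfrac1{1+\beta^2},\tfrac{\beta^2}{1+\beta^2}\big)$ in place of $\nu_n(a,b)$. -/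

import Mathlib

open MeasureTheory ProbabilityTheory Filter Topology

noncomputable section

/-- The sample average `E_n f(Z,A) = n⁻¹ ∑ f(Zᵢ,Aᵢ)` over the first `n` observations, at the
sample point `ω`, as a functional of `f`. The observations are indexed from `0`. -/
def sampleMean {Ω : Type*} (Zs As : ℕ → Ω → ℝ) (n : ℕ) (ω : Ω) (f : ℝ → ℝ → ℝ) : ℝ :=
  (n : ℝ)⁻¹ * ∑ i ∈ Finset.range n, f (Zs i ω) (As i ω)

/-- The expectation `E f(Z,A)`, as a functional of `f`. -/
def popMean {Ω : Type*} [MeasurableSpace Ω] (P : Measure Ω) (Z A : Ω → ℝ)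
    (f : ℝ → ℝ → ℝ) : ℝ :=
  ∫ ω, f (Z ω) (A ω) ∂P

/-- The Tversky index computed from an averaging functional `E` (the expectation, giving
`τ(a,b)`, or a sample average, giving `τ_n(a,b)`). -/
def tversky (E : (ℝ → ℝ → ℝ) → ℝ) (a b : ℝ) : ℝ :=
  E (fun z y => z * y) /
    (E (fun z y => z * y) + a * E (fun z y => y * (1 - z)) + b * E (fun z y => z * (1 - y)))

/-- The variance `ν(a,b)` (or `ν_n(a,b)`, for a sample average `E`). -/
def tverskyVar (E : (ℝ → ℝ → ℝ) → ℝ) (a b : ℝ) : ℝ :=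
  ((tversky E (a ^ 2) (b ^ 2))⁻¹ - 1 + ((tversky E a b)⁻¹ - 1) ^ 2) /
    (E (fun z y => z * y) * ((tversky E a b)⁻¹) ^ 4)

/-- Precision, `E(ZA) / E(A)`. -/
def precisionMeasure (E : (ℝ → ℝ → ℝ) → ℝ) : ℝ := E (fun z y => z * y) / E (fun _ y => y)

/-- Recall, `E(ZA) / E(Z)`. -/
def recallMeasure (E : (ℝ → ℝ → ℝ) → ℝ) : ℝ := E (fun z y => z * y) / E (fun z _ => z)

/-- The F-beta measure `(1 + β²) / (1 / precision + β² / recall)`. -/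
def fMeasure (E : (ℝ → ℝ → ℝ) → ℝ) (β : ℝ) : ℝ :=
  (1 + β ^ 2) / (1 / precisionMeasure E + β ^ 2 / recallMeasure E)

/-- The variance of the F-beta measure: the Tversky variance at `a = 1 / (1 + β²)` and
`b = β² / (1 + β²)`. -/
def fMeasureVar (E : (ℝ → ℝ → ℝ) → ℝ) (β : ℝ) : ℝ :=
  tverskyVar E (1 / (1 + β ^ 2)) (β ^ 2 / (1 + β ^ 2))

/-- The standard normal quantile `Φ⁻¹(p)`, for `0 < p < 1`. -/
def normalQuantile (p : ℝ) : ℝ := sInf {x : ℝ | p ≤ cdf (gaussianReal 0 1) x}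

/-- The closed interval `x ± h`. -/
def plusMinus (x h : ℝ) : Set ℝ := Set.Icc (x - h) (x + h)

end

/-!
The estimation error of the Tversky index is, up to a consistent factor, a sample mean of centred
variables. Put `D(E) = E(ZA) + a E(A(1-Z)) + b E(Z(1-A))`, so that `τ = E(ZA) / D(E)`, and
`W = ZA - τ (ZA + a A(1-Z) + b Z(1-A))`. Then `E W = 0` and, as soon as `D(E_n) ≠ 0`,
`√n (τ_n - τ) = √n E_n W / D(E_n)`. Since the products `ZA`, `A(1-Z)`, `Z(1-A)` are indicators of
disjoint events, `E W² = (1-τ)² E(ZA) + τ² (a² E(A(1-Z)) + b² E(Z(1-A)))`, which equals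
`D(E)² ν(a,b)` (`tverskyVar_identity`) and is positive because `P(Z ≠ A) > 0`.

The central limit theorem for `W`, the strong law for the three products, Slutsky's theorem and
the portmanteau theorem (`tendsto_real_abs_le_of_slutsky`) show that the event
`√n |τ_n - τ| ≤ c √ν_n` has asymptotic probability `P(|N| ≤ c)` for every real `c`
(`tendsto_tversky_coverage`). The event where `D(E_n) = 0` is absorbed by an additive remainder
that almost surely vanishes eventually, so no convention for the quotients matters.

The F measure is the Tversky index at `a = 1 / (1 + β²)`, `b = β² / (1 + β²)`, for the population
and for every sample (`fMeasure_eq_tversky`). For the level, `P(|N| ≤ Φ⁻¹(1 - α/2)) = 1 - α` by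
continuity and symmetry of `Φ`; the numerical claims follow from integrating the Taylor
polynomial of `exp (-t² / 2)` with an explicit error bound.
-/

/-! ### The standard normal distribution -/

theorem real_Icc_gaussianReal (x : ℝ) (hx : 0 ≤ x) :
    (gaussianReal 0 1).real (Set.Icc (-x) x) =
      2 * (√(2 * Real.pi))⁻¹ * ∫ t in (0 : ℝ)..x, Real.exp (-(t ^ 2 / 2)) := by
  have hint : ∀ c d : ℝ,
      IntervalIntegrable (fun t : ℝ => Real.exp (-(t ^ 2 / 2))) volume c d :=
    fun c d => (by fun_prop : Continuous fun t : ℝ => Real.exp (-(t ^ 2 / 2))).intervalIntegrable c d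
  have hneg : ∫ t in (-x)..0, Real.exp (-(t ^ 2 / 2)) =
      ∫ t in (0 : ℝ)..x, Real.exp (-(t ^ 2 / 2)) := by
    have := intervalIntegral.integral_comp_neg (a := -x) (b := 0)
      (fun t : ℝ => Real.exp (-(t ^ 2 / 2)))
    simpa using this
  rw [measureReal_def, gaussianReal_apply_eq_integral 0 one_ne_zero,
    ENNReal.toReal_ofReal (integral_nonneg fun t => gaussianPDFReal_nonneg _ _ _),
    integral_Icc_eq_integral_Ioc, ← intervalIntegral.integral_of_le (by linarith)]
  simp only [gaussianPDFReal_def, sub_zero, NNReal.coe_one, mul_one]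
  rw [intervalIntegral.integral_const_mul]
  have hfun : (fun t : ℝ => Real.exp (-t ^ 2 / 2)) = fun t => Real.exp (-(t ^ 2 / 2)) := by
    funext t; congr 1; ring
  rw [hfun, ← intervalIntegral.integral_add_adjacent_intervals (hint (-x) 0) (hint 0 x), hneg]
  ring

theorem cdf_neg_gaussianReal (x : ℝ) :
    cdf (gaussianReal 0 1) (-x) = 1 - cdf (gaussianReal 0 1) x := by
  have : NullSingletonClass (gaussianReal 0 1) := nullSingletonClass_gaussianReal one_ne_zero
  rw [cdf_eq_real, cdf_eq_real, ← probReal_compl_eq_one_sub measurableSet_Iic, Set.compl_Iic,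
    measureReal_congr (Ioi_ae_eq_Ici (μ := gaussianReal 0 1) (a := x))]
  have h : (gaussianReal 0 1).map (fun y => -y) = gaussianReal 0 1 := by
    rw [gaussianReal_map_neg, neg_zero]
  conv_rhs => rw [← h]
  rw [map_measureReal_apply measurable_neg measurableSet_Ici]
  congr 1
  ext y
  simp

theorem real_Icc_gaussianReal_eq_cdf (x : ℝ) (hx : 0 ≤ x) :
    (gaussianReal 0 1).real (Set.Icc (-x) x) = 2 * cdf (gaussianReal 0 1) x - 1 := by
  have : NullSingletonClass (gaussianReal 0 1) := nullSingletonClass_gaussianReal one_ne_zero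
  rw [measureReal_congr (Ioc_ae_eq_Icc (μ := gaussianReal 0 1)).symm,
    ← Set.Iic_sdiff_Iic, measureReal_sdiff (Set.Iic_subset_Iic.2 (by linarith)) measurableSet_Iic,
    ← cdf_eq_real, ← cdf_eq_real, cdf_neg_gaussianReal]
  ring

theorem continuous_cdf_gaussianReal : Continuous (cdf (gaussianReal 0 1)) := by
  have : NullSingletonClass (gaussianReal 0 1) := nullSingletonClass_gaussianReal one_ne_zero
  refine continuous_iff_continuousAt.2 fun x => ?_
  rw [(monotone_cdf _).continuousAt_iff_leftLim_eq_rightLim, StieltjesFunction.rightLim_eq]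
  have h := (cdf (gaussianReal 0 1)).measure_singleton x
  rw [measure_cdf, measure_singleton] at h
  have h1 := ENNReal.ofReal_eq_zero.1 h.symm
  exact le_antisymm ((monotone_cdf _).leftLim_le le_rfl) (by linarith)

/-- The infimum defining the quantile is attained, because `Φ` is continuous and takes the value `p`
by the intermediate value theorem. -/
theorem cdf_normalQuantile {p : ℝ} (h0 : 0 < p) (h1 : p < 1) :
    cdf (gaussianReal 0 1) (normalQuantile p) = p := by
  obtain ⟨x, hx⟩ : ∃ x, cdf (gaussianReal 0 1) x = p := by
    obtain ⟨l, hl⟩ := ((tendsto_cdf_atBot (gaussianReal 0 1)).eventually (gt_mem_nhds h0)).exists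
    obtain ⟨u, hu⟩ := ((tendsto_cdf_atTop (gaussianReal 0 1)).eventually (lt_mem_nhds h1)).exists
    exact mem_range_of_exists_le_of_exists_ge continuous_cdf_gaussianReal ⟨l, hl.le⟩ ⟨u, hu.le⟩
  have hbdd : BddBelow {y : ℝ | p ≤ cdf (gaussianReal 0 1) y} := by
    obtain ⟨l, hl⟩ := ((tendsto_cdf_atBot (gaussianReal 0 1)).eventually (gt_mem_nhds h0)).exists
    exact ⟨l, fun y hy => le_of_lt <| (monotone_cdf _).reflect_lt (hl.trans_le hy)⟩
  have hmem : normalQuantile p ∈ {y : ℝ | p ≤ cdf (gaussianReal 0 1) y} :=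
    (isClosed_le continuous_const continuous_cdf_gaussianReal).csInf_mem ⟨x, hx.ge⟩ hbdd
  exact le_antisymm ((monotone_cdf _ (csInf_le hbdd hx.ge)).trans hx.le) hmem

theorem real_Icc_normalQuantile {α : ℝ} (h0 : 0 < α) (h1 : α < 1) :
    (gaussianReal 0 1).real
      (Set.Icc (-normalQuantile (1 - α / 2)) (normalQuantile (1 - α / 2))) = 1 - α := by
  have hq : cdf (gaussianReal 0 1) (normalQuantile (1 - α / 2)) = 1 - α / 2 :=
    cdf_normalQuantile (by linarith) (by linarith)
  have hnn : 0 ≤ normalQuantile (1 - α / 2) := by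
    by_contra! h
    have := monotone_cdf (gaussianReal 0 1) (by linarith :
      normalQuantile (1 - α / 2) ≤ -normalQuantile (1 - α / 2))
    rw [cdf_neg_gaussianReal, hq] at this
    linarith
  rw [real_Icc_gaussianReal_eq_cdf _ hnn, hq]
  ring

theorem abs_exp_neg_sub_sum_le {u : ℝ} (h0 : 0 ≤ u) (h2 : u ≤ 2) :
    |Real.exp (-u) - ∑ k ∈ Finset.range 14, (-u) ^ k / (k.factorial : ℝ)| ≤ 4e-7 := by
  have h := Complex.exp_bound' (x := ((-u : ℝ) : ℂ)) (n := 14) (by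
    rw [Complex.norm_real, Real.norm_eq_abs, abs_neg, abs_of_nonneg h0]
    norm_num
    linarith)
  rw [Complex.norm_real, Real.norm_eq_abs, abs_neg, abs_of_nonneg h0] at h
  have h' : |Real.exp (-u) - ∑ k ∈ Finset.range 14, (-u) ^ k / (k.factorial : ℝ)| ≤
      u ^ 14 / (Nat.factorial 14 : ℝ) * 2 := by
    rw [← Real.norm_eq_abs, ← Complex.norm_real]
    exact_mod_cast h
  refine h'.trans ?_
  have : u ^ 14 ≤ 2 ^ 14 := by gcongr
  calc u ^ 14 / (Nat.factorial 14 : ℝ) * 2 ≤ 2 ^ 14 / (Nat.factorial 14 : ℝ) * 2 := by gcongr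
    _ ≤ 4e-7 := by norm_num [Nat.factorial]

/-- The sum is the integral over `[0, x]` of the Taylor polynomial of `exp` at `-(t ^ 2 / 2)`; the
restriction `x ≤ 2` keeps `t ^ 2 / 2` in the range of `abs_exp_neg_sub_sum_le`. -/
theorem abs_integral_sub_sum_le {x : ℝ} (h0 : 0 ≤ x) (h2 : x ≤ 2) :
    |(∫ t in (0 : ℝ)..x, Real.exp (-(t ^ 2 / 2))) -
      ∑ k ∈ Finset.range 14, (-1 / 2) ^ k / (k.factorial : ℝ) * (x ^ (2 * k + 1) / (2 * k + 1))|
      ≤ 1e-6 := by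
  have hsum : ∫ t in (0 : ℝ)..x, ∑ k ∈ Finset.range 14, (-(t ^ 2 / 2)) ^ k / (k.factorial : ℝ) =
      ∑ k ∈ Finset.range 14, (-1 / 2) ^ k / (k.factorial : ℝ) * (x ^ (2 * k + 1) / (2 * k + 1)) := by
    rw [intervalIntegral.integral_finsetSum fun k _ =>
      (by fun_prop : Continuous fun t : ℝ =>
        (-(t ^ 2 / 2)) ^ k / (k.factorial : ℝ)).intervalIntegrable _ _]
    refine Finset.sum_congr rfl fun k _ => ?_
    have : (fun t : ℝ => (-(t ^ 2 / 2)) ^ k / (k.factorial : ℝ)) =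
        fun t => (-1 / 2) ^ k / (k.factorial : ℝ) * t ^ (2 * k) := by
      funext t
      rw [pow_mul, show -(t ^ 2 / 2) = (-1 / 2) * t ^ 2 by ring, mul_pow]
      ring
    rw [this, intervalIntegral.integral_const_mul, integral_pow]
    simp
  rw [← hsum, ← intervalIntegral.integral_sub
    ((by fun_prop : Continuous fun t : ℝ => Real.exp (-(t ^ 2 / 2))).intervalIntegrable _ _)
    ((by fun_prop : Continuous fun t : ℝ => ∑ k ∈ Finset.range 14,
      (-(t ^ 2 / 2)) ^ k / (k.factorial : ℝ)).intervalIntegrable _ _)]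
  have := intervalIntegral.norm_integral_le_of_norm_le_const (a := 0) (b := x) (C := 4e-7)
    (f := fun t : ℝ => Real.exp (-(t ^ 2 / 2)) -
      ∑ k ∈ Finset.range 14, (-(t ^ 2 / 2)) ^ k / (k.factorial : ℝ)) (by
    intro t ht
    rw [Set.uIoc_of_le h0] at ht
    exact abs_exp_neg_sub_sum_le (by positivity) (by nlinarith [ht.1, ht.2]))
  rw [Real.norm_eq_abs, sub_zero, abs_of_nonneg h0] at this
  linarith

theorem inv_sqrt_two_pi_bounds :
    0.398942 < (√(2 * Real.pi))⁻¹ ∧ (√(2 * Real.pi))⁻¹ < 0.398943 := by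
  have h1 := Real.pi_gt_d6
  have h2 := Real.pi_lt_d6
  have hpos : 0 < √(2 * Real.pi) := by positivity
  have hs : √(2 * Real.pi) ^ 2 = 2 * Real.pi := Real.sq_sqrt (by positivity)
  constructor
  · rw [lt_inv_comm₀ (by norm_num) hpos]
    exact lt_of_pow_lt_pow_left₀ 2 (by norm_num) (by rw [hs]; norm_num at *; linarith)
  · rw [inv_lt_comm₀ hpos (by norm_num)]
    exact lt_of_pow_lt_pow_left₀ 2 hpos.le (by rw [hs]; norm_num at *; linarith)

theorem abs_real_Icc_gaussianReal_sub_lt :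
    |(gaussianReal 0 1).real (Set.Icc (-1.96) 1.96) - 0.95| < 0.0005 := by
  have h := abs_le.1 (abs_integral_sub_sum_le (x := 1.96) (by norm_num) (by norm_num))
  obtain ⟨c1, c2⟩ := inv_sqrt_two_pi_bounds
  rw [real_Icc_gaussianReal 1.96 (by norm_num)]
  norm_num [Finset.sum_range_succ, Nat.factorial] at h c1 c2
  rw [abs_lt]
  constructor <;> norm_num <;> nlinarith [h.1, h.2]

/-- Since `Φ` is monotone, it suffices that `Φ(1.955) < 0.975 < Φ(1.965)`. -/
theorem abs_normalQuantile_sub_lt : |normalQuantile (1 - 0.05 / 2) - 1.96| < 0.005 := by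
  have hq : cdf (gaussianReal 0 1) (normalQuantile (1 - 0.05 / 2)) = 1 - 0.05 / 2 :=
    cdf_normalQuantile (by norm_num) (by norm_num)
  obtain ⟨c1, c2⟩ := inv_sqrt_two_pi_bounds
  have hl : cdf (gaussianReal 0 1) 1.955 < 1 - 0.05 / 2 := by
    have h := abs_le.1 (abs_integral_sub_sum_le (x := 1.955) (by norm_num) (by norm_num))
    have e := real_Icc_gaussianReal 1.955 (by norm_num)
    rw [real_Icc_gaussianReal_eq_cdf _ (by norm_num)] at e
    norm_num [Finset.sum_range_succ, Nat.factorial] at h c1 c2 e ⊢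
    nlinarith [h.1, h.2]
  have hu : 1 - 0.05 / 2 < cdf (gaussianReal 0 1) 1.965 := by
    have h := abs_le.1 (abs_integral_sub_sum_le (x := 1.965) (by norm_num) (by norm_num))
    have e := real_Icc_gaussianReal 1.965 (by norm_num)
    rw [real_Icc_gaussianReal_eq_cdf _ (by norm_num)] at e
    norm_num [Finset.sum_range_succ, Nat.factorial] at h c1 c2 e ⊢
    nlinarith [h.1, h.2]
  rw [← hq] at hl hu
  have h1 := (monotone_cdf _).reflect_lt hl
  have h2 := (monotone_cdf _).reflect_lt hu
  rw [abs_lt]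
  constructor <;> linarith

/-! ### Slutsky and portmanteau -/

/-- Asymptotic coverage of a studentized statistic: if `V n` converges in law to `s N` with `N`
standard normal, and `Y n → y`, `U n → 0`, `R n → r = s y` almost surely, then
`P(|V n * Y n + U n| ≤ c * R n)` tends to `P(|N| ≤ c)`. No sign is assumed for `c`. -/
theorem tendsto_real_abs_le_of_slutsky {Ω : Type*} [MeasurableSpace Ω] {P : Measure Ω}
    [IsProbabilityMeasure P] {V Y U R : ℕ → Ω → ℝ} {s y r : ℝ} (c : ℝ)
    (hV : TendstoInDistribution V atTop (fun x : ℝ => s * x) (fun _ => P) (gaussianReal 0 1))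
    (hYm : ∀ n, AEMeasurable (Y n) P) (hUm : ∀ n, AEMeasurable (U n) P)
    (hRm : ∀ n, AEMeasurable (R n) P)
    (hY : ∀ᵐ ω ∂P, Tendsto (fun n => Y n ω) atTop (𝓝 y))
    (hU : ∀ᵐ ω ∂P, Tendsto (fun n => U n ω) atTop (𝓝 0))
    (hR : ∀ᵐ ω ∂P, Tendsto (fun n => R n ω) atTop (𝓝 r))
    (hr : 0 < r) (hsy : s * y = r) :
    Tendsto (fun n => P.real {ω | |V n ω * Y n ω + U n ω| ≤ c * R n ω}) atTop
      (𝓝 ((gaussianReal 0 1).real (Set.Icc (-c) c))) := by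
  have hm : ∀ n, AEMeasurable (fun ω => (Y n ω, U n ω, R n ω)) P := fun n =>
    (hYm n).prodMk ((hUm n).prodMk (hRm n))
  have hconv : TendstoInMeasure P (fun n ω => (Y n ω, U n ω, R n ω)) atTop
      (fun _ => (y, (0 : ℝ), r)) := by
    refine tendstoInMeasure_of_tendsto_ae (fun n => (hm n).aestronglyMeasurable) ?_
    filter_upwards [hY, hU, hR] with ω h1 h2 h3
    exact h1.prodMk_nhds (h2.prodMk_nhds h3)
  -- The event is `g (V n, Y n, U n, R n) ≤ 0` for a continuous `g`, so it is enough to know that the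
  -- limit law of this real variable, that of `r * (|N| - c)`, has no atom at `0`.
  have hD := hV.continuous_comp_prodMk_of_tendstoInMeasure_const
    (g := fun q : ℝ × ℝ × ℝ × ℝ => |q.1 * q.2.1 + q.2.2.1| - c * q.2.2.2)
    (by fun_prop) hconv hm
  have hlim : (fun x : ℝ => |s * x * y + 0| - c * r) = fun x => r * (|x| - c) := by
    funext x
    rw [add_zero, show s * x * y = r * x by rw [← hsy]; ring, abs_mul, abs_of_pos hr]
    ring
  have hnull : (gaussianReal 0 1).map (fun x : ℝ => |s * x * y + 0| - c * r)
      (frontier (Set.Iic 0)) = 0 := by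
    have : NullSingletonClass (gaussianReal 0 1) := nullSingletonClass_gaussianReal one_ne_zero
    rw [hlim, frontier_Iic, Measure.map_apply (by fun_prop) (measurableSet_singleton _)]
    refine measure_mono_null (t := {c, -c}) (fun x hx => ?_) (Set.Countable.measure_zero (by simp) _)
    have hx' : r * (|x| - c) = 0 := hx
    have hxc : |x| = c := by
      rcases mul_eq_zero.1 hx' with h | h <;> linarith
    exact eq_or_eq_neg_of_abs_eq hxc
  have hpm := ProbabilityMeasure.tendsto_measure_of_null_frontier_of_tendsto' hD.tendsto hnull
  have hlimset : (gaussianReal 0 1).map (fun x : ℝ => |s * x * y + 0| - c * r) (Set.Iic 0) =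
      gaussianReal 0 1 (Set.Icc (-c) c) := by
    rw [hlim, Measure.map_apply (by fun_prop) measurableSet_Iic]
    congr 1
    ext x
    simp only [Set.mem_preimage, Set.mem_Iic, Set.mem_Icc, ← abs_le]
    rw [mul_nonpos_iff_pos_imp_nonpos]
    constructor
    · intro h; linarith [h.1 hr]
    · intro h; exact ⟨fun _ => by linarith, fun _ => hr.le⟩
  simp only [ProbabilityMeasure.coe_mk, hlimset] at hpm
  have hreal := (ENNReal.tendsto_toReal (measure_ne_top (gaussianReal 0 1) _)).comp hpm
  refine hreal.congr fun n => ?_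
  simp only [Function.comp_apply, measureReal_def]
  rw [Measure.map_apply_of_aemeasurable (hD.forall_aemeasurable n) measurableSet_Iic]
  congr 2
  ext ω
  simp

/-! ### Algebra of the Tversky index and the F measure -/

theorem tendsto_tversky {E : (ℝ → ℝ → ℝ) → ℝ} {En : ℕ → (ℝ → ℝ → ℝ) → ℝ} {a b : ℝ}
    (hp : Tendsto (fun n => En n fun z y => z * y) atTop (𝓝 (E fun z y => z * y)))
    (hq : Tendsto (fun n => En n fun z y => y * (1 - z)) atTop (𝓝 (E fun z y => y * (1 - z))))
    (hr : Tendsto (fun n => En n fun z y => z * (1 - y)) atTop (𝓝 (E fun z y => z * (1 - y))))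
    (hD : E (fun z y => z * y) + a * E (fun z y => y * (1 - z)) +
      b * E (fun z y => z * (1 - y)) ≠ 0) :
    Tendsto (fun n => tversky (En n) a b) atTop (𝓝 (tversky E a b)) :=
  hp.div ((hp.add (hq.const_mul a)).add (hr.const_mul b)) hD

theorem tendsto_tverskyVar {E : (ℝ → ℝ → ℝ) → ℝ} {En : ℕ → (ℝ → ℝ → ℝ) → ℝ} {a b : ℝ}
    (hp : Tendsto (fun n => En n fun z y => z * y) atTop (𝓝 (E fun z y => z * y)))
    (hq : Tendsto (fun n => En n fun z y => y * (1 - z)) atTop (𝓝 (E fun z y => y * (1 - z))))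
    (hr : Tendsto (fun n => En n fun z y => z * (1 - y)) atTop (𝓝 (E fun z y => z * (1 - y))))
    (hp0 : 0 < E fun z y => z * y) (hq0 : 0 ≤ E fun z y => y * (1 - z))
    (hr0 : 0 ≤ E fun z y => z * (1 - y)) (ha : 0 < a) (hb : 0 < b) :
    Tendsto (fun n => tverskyVar (En n) a b) atTop (𝓝 (tverskyVar E a b)) := by
  have hτ : tversky E a b ≠ 0 := by unfold tversky; positivity
  have hτ2 : tversky E (a ^ 2) (b ^ 2) ≠ 0 := by unfold tversky; positivity
  have h1 := (tendsto_tversky (a := a) (b := b) hp hq hr (by positivity)).inv₀ hτ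
  have h2 := (tendsto_tversky (a := a ^ 2) (b := b ^ 2) hp hq hr (by positivity)).inv₀ hτ2
  exact ((h2.sub_const 1).add ((h1.sub_const 1).pow 2)).div (hp.mul (h1.pow 4))
    (mul_ne_zero hp0.ne' (pow_ne_zero _ (inv_ne_zero hτ)))

theorem inv_tversky_sub_one {E : (ℝ → ℝ → ℝ) → ℝ} (a b : ℝ)
    (hp0 : E (fun z y => z * y) ≠ 0) :
    (tversky E a b)⁻¹ - 1 = (a * E (fun z y => y * (1 - z)) + b * E (fun z y => z * (1 - y))) /
      E fun z y => z * y := by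
  rw [tversky, inv_div]
  field_simp
  ring

/-- The left side is `E W²` for the centred variable `W = ZA - τ (ZA + a A(1-Z) + b Z(1-A))`, so the
asymptotic variance `ν(a,b)` is `E W²` divided by the squared denominator of the Tversky index. -/
theorem tverskyVar_identity {E : (ℝ → ℝ → ℝ) → ℝ} {a b : ℝ}
    (hp0 : 0 < E fun z y => z * y) (hq0 : 0 ≤ E fun z y => y * (1 - z))
    (hr0 : 0 ≤ E fun z y => z * (1 - y))
    (hqr : 0 < E (fun z y => y * (1 - z)) + E (fun z y => z * (1 - y)))
    (ha : 0 < a) (hb : 0 < b) :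
    0 < tverskyVar E a b ∧
      (1 - tversky E a b) ^ 2 * E (fun z y => z * y) +
          (tversky E a b * a) ^ 2 * E (fun z y => y * (1 - z)) +
          (tversky E a b * b) ^ 2 * E (fun z y => z * (1 - y)) =
        (E (fun z y => z * y) + a * E (fun z y => y * (1 - z)) +
          b * E (fun z y => z * (1 - y))) ^ 2 * tverskyVar E a b := by
  have hτ : 0 < tversky E a b := by unfold tversky; positivity
  constructor
  · have h1 : 0 < (tversky E a b)⁻¹ - 1 := by
      rw [inv_tversky_sub_one a b hp0.ne']
      refine div_pos ?_ hp0
      rcases hq0.eq_or_lt with h | h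
      · rw [← h] at hqr ⊢
        nlinarith [mul_pos hb (by linarith : 0 < E fun z y => z * (1 - y))]
      · positivity
    have h2 : 0 ≤ (tversky E (a ^ 2) (b ^ 2))⁻¹ - 1 := by
      rw [inv_tversky_sub_one _ _ hp0.ne']
      positivity
    unfold tverskyVar
    positivity
  · rw [tverskyVar, inv_tversky_sub_one _ _ hp0.ne', inv_tversky_sub_one _ _ hp0.ne', tversky,
      inv_div]
    generalize E (fun z y => z * y) = p at *
    generalize E (fun z y => y * (1 - z)) = q at *
    generalize E (fun z y => z * (1 - y)) = r at *
    have : p + a * q + b * r ≠ 0 := by positivity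
    field_simp
    ring

/-- The F measure is a Tversky index for any averaging functional that is additive on the two
marginals. Division by zero needs no exclusion: both sides reduce to the same quotient with
numerator `(1 + β²) E(ZA)`, also when `E(ZA)`, `E(A)` or `E(Z)` vanishes. -/
theorem fMeasure_eq_tversky {E : (ℝ → ℝ → ℝ) → ℝ}
    (hA : E (fun _ y => y) = E (fun z y => z * y) + E (fun z y => y * (1 - z)))
    (hZ : E (fun z _ => z) = E (fun z y => z * y) + E (fun z y => z * (1 - y))) (β : ℝ) :
    fMeasure E β = tversky E (1 / (1 + β ^ 2)) (β ^ 2 / (1 + β ^ 2)) := by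
  have hβ : (1 + β ^ 2) ≠ 0 := by positivity
  unfold fMeasure tversky precisionMeasure recallMeasure
  have hden : E (fun z y => z * y) + 1 / (1 + β ^ 2) * E (fun z y => y * (1 - z)) +
      β ^ 2 / (1 + β ^ 2) * E (fun z y => z * (1 - y)) =
      (E (fun _ y => y) + β ^ 2 * E (fun z _ => z)) / (1 + β ^ 2) := by
    rw [hA, hZ]
    field_simp
    ring
  rw [hden, one_div_div, div_div_eq_mul_div (β ^ 2), ← add_div, div_div_eq_mul_div,
    div_div_eq_mul_div, mul_comm]

theorem sampleMean_eq_add {Ω : Type*} (Zs As : ℕ → Ω → ℝ) (n : ℕ) (ω : Ω) {f g h : ℝ → ℝ → ℝ}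
    (hf : ∀ z y, f z y = g z y + h z y) :
    sampleMean Zs As n ω f = sampleMean Zs As n ω g + sampleMean Zs As n ω h := by
  simp only [sampleMean, hf, Finset.sum_add_distrib, mul_add]

/-! ### Binary observations -/

section

variable {Ω : Type*} [MeasurableSpace Ω] {P : Measure Ω} {Z A : Ω → ℝ} {Zs As : ℕ → Ω → ℝ}

theorem popMean_nonneg (hval : ∀ᵐ ω ∂P, (Z ω = 0 ∨ Z ω = 1) ∧ (A ω = 0 ∨ A ω = 1))
    {f : ℝ → ℝ → ℝ} (h00 : 0 ≤ f 0 0) (h01 : 0 ≤ f 0 1) (h10 : 0 ≤ f 1 0) (h11 : 0 ≤ f 1 1) :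
    0 ≤ popMean P Z A f := by
  refine integral_nonneg_of_ae ?_
  filter_upwards [hval] with ω ⟨hz, ha⟩
  rcases hz with hz | hz <;> rcases ha with ha | ha <;> simpa [hz, ha]

variable [IsProbabilityMeasure P]

theorem memLp_comp_of_binary
    (hval : ∀ᵐ ω ∂P, (Z ω = 0 ∨ Z ω = 1) ∧ (A ω = 0 ∨ A ω = 1))
    (hZA : AEMeasurable (fun ω => (Z ω, A ω)) P) {f : ℝ → ℝ → ℝ}
    (hf : Measurable (Function.uncurry f)) (q : ENNReal) :
    MemLp (fun ω => f (Z ω) (A ω)) q P := by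
  refine MemLp.of_bound (hf.comp_aemeasurable hZA).aestronglyMeasurable
    (|f 0 0| + |f 0 1| + |f 1 0| + |f 1 1|) ?_
  filter_upwards [hval] with ω ⟨hz, ha⟩
  have h00 := abs_nonneg (f 0 0)
  have h01 := abs_nonneg (f 0 1)
  have h10 := abs_nonneg (f 1 0)
  have h11 := abs_nonneg (f 1 1)
  rcases hz with hz | hz <;> rcases ha with ha | ha <;> rw [hz, ha, Real.norm_eq_abs] <;> linarith

theorem tendsto_sampleMean
    (hval : ∀ᵐ ω ∂P, (Z ω = 0 ∨ Z ω = 1) ∧ (A ω = 0 ∨ A ω = 1))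
    (hindep : iIndepFun (fun (i : ℕ) (ω : Ω) => (Zs i ω, As i ω)) P)
    (hident : ∀ i : ℕ, IdentDistrib (fun ω => (Zs i ω, As i ω)) (fun ω => (Z ω, A ω)) P P)
    {f : ℝ → ℝ → ℝ} (hf : Measurable (Function.uncurry f)) :
    ∀ᵐ ω ∂P, Tendsto (fun n => sampleMean Zs As n ω f) atTop (𝓝 (popMean P Z A f)) := by
  have hid : ∀ i, IdentDistrib (fun ω => f (Zs i ω) (As i ω)) (fun ω => f (Z ω) (A ω)) P P :=
    fun i => (hident i).comp hf
  have hint : Integrable (fun ω => f (Z ω) (A ω)) P :=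
    (memLp_comp_of_binary hval (hident 0).aemeasurable_snd hf 1).integrable le_rfl
  have h := strong_law_ae_real (fun i ω => f (Zs i ω) (As i ω)) ((hid 0).integrable_iff.2 hint)
    (fun i j hij => (hindep.comp (fun _ => Function.uncurry f) fun _ => hf).indepFun hij)
    (fun i => (hid i).trans (hid 0).symm)
  rw [(hid 0).integral_eq] at h
  filter_upwards [h] with ω hω
  refine hω.congr fun n => ?_
  rw [sampleMean, div_eq_inv_mul]

/-- A function on `{0,1}²` that vanishes at `(0,0)` has an expectation determined by its other three
values and the probabilities of these points. -/
theorem popMean_linear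
    (hval : ∀ᵐ ω ∂P, (Z ω = 0 ∨ Z ω = 1) ∧ (A ω = 0 ∨ A ω = 1))
    (hZA : AEMeasurable (fun ω => (Z ω, A ω)) P) {f : ℝ → ℝ → ℝ} (x y w : ℝ)
    (h00 : f 0 0 = 0) (h11 : f 1 1 = x) (h01 : f 0 1 = y) (h10 : f 1 0 = w) :
    popMean P Z A f = x * popMean P Z A (fun z y => z * y) +
      y * popMean P Z A (fun z y => y * (1 - z)) + w * popMean P Z A (fun z y => z * (1 - y)) := by
  have hi : ∀ {g : ℝ → ℝ → ℝ}, Measurable (Function.uncurry g) →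
      Integrable (fun ω => g (Z ω) (A ω)) P := fun hg =>
    (memLp_comp_of_binary hval hZA hg 1).integrable le_rfl
  have hp := hi (g := fun z y => z * y) (by unfold Function.uncurry; fun_prop)
  have hq := hi (g := fun z y => y * (1 - z)) (by unfold Function.uncurry; fun_prop)
  have hr := hi (g := fun z y => z * (1 - y)) (by unfold Function.uncurry; fun_prop)
  have hpq : Integrable (fun ω => x * (Z ω * A ω) + y * (A ω * (1 - Z ω))) P :=
    (hp.const_mul x).add (hq.const_mul y)
  unfold popMean
  rw [← integral_const_mul, ← integral_const_mul, ← integral_const_mul,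
    ← integral_add (hp.const_mul x) (hq.const_mul y), ← integral_add hpq (hr.const_mul w)]
  refine integral_congr_ae ?_
  filter_upwards [hval] with ω ⟨hz, ha⟩
  rcases hz with hz | hz <;> rcases ha with ha | ha <;> simp [hz, ha, h00, h11, h01, h10]

theorem popMean_pos (hval : ∀ᵐ ω ∂P, (Z ω = 0 ∨ Z ω = 1) ∧ (A ω = 0 ∨ A ω = 1))
    (hZA : AEMeasurable (fun ω => (Z ω, A ω)) P)
    {f : ℝ → ℝ → ℝ} (hf : Measurable (Function.uncurry f))
    (h00 : 0 ≤ f 0 0) (h01 : 0 ≤ f 0 1) (h10 : 0 ≤ f 1 0) (h11 : 0 ≤ f 1 1) {S : Set Ω}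
    (hS : 0 < P S) (hfS : ∀ᵐ ω ∂P, ω ∈ S → f (Z ω) (A ω) ≠ 0) :
    0 < popMean P Z A f := by
  refine (integral_pos_iff_support_of_nonneg_ae ?_
    ((memLp_comp_of_binary hval hZA hf 1).integrable le_rfl)).2
    (hS.trans_le (measure_mono_ae ?_))
  · filter_upwards [hval] with ω ⟨hz, ha⟩
    rcases hz with hz | hz <;> rcases ha with ha | ha <;> simpa [hz, ha]
  · filter_upwards [hfS] with ω h hω using h hω

/-! ### Asymptotic coverage -/

/-- Asymptotic coverage of the Tversky interval with an arbitrary multiplier `c`. -/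
theorem tendsto_tversky_coverage
    (hval : ∀ᵐ ω ∂P, (Z ω = 0 ∨ Z ω = 1) ∧ (A ω = 0 ∨ A ω = 1))
    (hindep : iIndepFun (fun (i : ℕ) (ω : Ω) => (Zs i ω, As i ω)) P)
    (hident : ∀ i : ℕ, IdentDistrib (fun ω => (Zs i ω, As i ω)) (fun ω => (Z ω, A ω)) P P)
    (hpos : 0 < P {ω | Z ω = 1 ∧ A ω = 1}) (hne : 0 < P {ω | Z ω ≠ A ω})
    {a b : ℝ} (ha : 0 < a) (hb : 0 < b) (c : ℝ) :
    Tendsto (fun n : ℕ => P.real {ω | tversky (popMean P Z A) a b ∈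
        plusMinus (tversky (sampleMean Zs As n ω) a b)
          (c * Real.sqrt (tverskyVar (sampleMean Zs As n ω) a b / n))})
      atTop (𝓝 ((gaussianReal 0 1).real (Set.Icc (-c) c))) := by
  have hZA := (hident 0).aemeasurable_snd
  have hmp : Measurable (Function.uncurry fun z y : ℝ => z * y) := by
    unfold Function.uncurry; fun_prop
  have hmq : Measurable (Function.uncurry fun z y : ℝ => y * (1 - z)) := by
    unfold Function.uncurry; fun_prop
  have hmr : Measurable (Function.uncurry fun z y : ℝ => z * (1 - y)) := by
    unfold Function.uncurry; fun_prop
  set E := popMean P Z A with hE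
  have hp0 : 0 < E fun z y => z * y := by
    refine popMean_pos hval hZA hmp (by simp) (by simp) (by simp) (by simp) hpos ?_
    exact .of_forall fun ω hω => by simp [hω.1, hω.2]
  have hq0 : 0 ≤ E fun z y => y * (1 - z) :=
    popMean_nonneg hval (by simp) (by simp) (by simp) (by simp)
  have hr0 : 0 ≤ E fun z y => z * (1 - y) :=
    popMean_nonneg hval (by simp) (by simp) (by simp) (by simp)
  have hqr : 0 < E (fun z y => y * (1 - z)) + E (fun z y => z * (1 - y)) := by
    -- On `{0,1}²` the sum is `(z - y) ^ 2`, which is nonzero exactly where `Z ≠ A`.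
    have h1 : 0 < E fun z y => (z - y) ^ 2 := by
      refine popMean_pos hval hZA (by unfold Function.uncurry; fun_prop) (by simp) (by simp)
        (by simp) (by simp) hne ?_
      exact .of_forall fun ω hω => pow_ne_zero _ (sub_ne_zero.2 hω)
    have h2 := popMean_linear (f := fun z y => (z - y) ^ 2) hval hZA 0 1 1
      (by simp) (by simp) (by simp) (by simp)
    rw [← hE] at h2
    linarith
  set τ := tversky E a b with hτ
  set W : ℝ → ℝ → ℝ := fun z y => z * y - τ * (z * y + a * (y * (1 - z)) + b * (z * (1 - y)))
    with hW
  have hmW : Measurable (Function.uncurry W) := by unfold Function.uncurry; fun_prop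
  set D : ((ℝ → ℝ → ℝ) → ℝ) → ℝ := fun F => F (fun z y => z * y) +
    a * F (fun z y => y * (1 - z)) + b * F (fun z y => z * (1 - y)) with hD
  have hD0 : 0 < D E := by positivity
  have hmean : E W = 0 := by
    rw [hE, popMean_linear (f := W) hval hZA (1 - τ) (-τ * a) (-τ * b)
      (by simp [hW]) (by simp [hW]) (by simp [hW]) (by simp [hW]), ← hE]
    have : τ * D E = E fun z y => z * y := div_mul_cancel₀ _ hD0.ne'
    simp only [hD] at this
    linarith
  have hν : 0 < tverskyVar E a b ∧ E (fun z y => W z y ^ 2) = D E ^ 2 * tverskyVar E a b := by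
    rw [hE, popMean_linear (f := fun z y => W z y ^ 2) hval hZA ((1 - τ) ^ 2) ((τ * a) ^ 2)
      ((τ * b) ^ 2) (by simp [hW]) (by simp [hW]) (by simp [hW]) (by simp [hW]), ← hE]
    exact tverskyVar_identity hp0 hq0 hr0 hqr ha hb
  obtain ⟨hν0, hsq⟩ := hν
  set X : ℕ → Ω → ℝ := fun i ω => W (Zs i ω) (As i ω) with hX
  have hid : ∀ i, IdentDistrib (X i) (fun ω => W (Z ω) (A ω)) P P := fun i => (hident i).comp hmW
  have hX0 : P[X 0] = 0 := (hid 0).integral_eq.trans hmean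
  have hvar : Var[X 0; P] = D E ^ 2 * tverskyVar E a b := by
    rw [(hid 0).variance_eq, variance_of_integral_eq_zero (hid 0).aemeasurable_snd hmean, ← hsq]
    rfl
  have hCLT := tendstoInDistribution_inv_sqrt_mul_sum_sub (X := X) (P := P)
    (Y := fun x : ℝ => D E * √(tverskyVar E a b) * x) (P' := gaussianReal 0 1)
    (by
      convert gaussianReal_const_mul (X := fun x : ℝ => x) (P := gaussianReal 0 1)
        (μ := 0) (v := 1) .id (D E * √(tverskyVar E a b)) using 2
      · simp
      · rw [hvar, ← NNReal.coe_inj, Real.coe_toNNReal _ (by positivity)]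
        simp [mul_pow, Real.sq_sqrt hν0.le])
    ((hid 0).memLp_iff.2 (memLp_comp_of_binary hval hZA hmW 2))
    (hindep.comp (fun _ => Function.uncurry W) fun _ => hmW)
    (fun i => (hid i).trans (hid 0).symm)
  rw [hX0] at hCLT
  have hmean_meas : ∀ n {f : ℝ → ℝ → ℝ}, Measurable (Function.uncurry f) →
      AEMeasurable (fun ω => sampleMean Zs As n ω f) P := fun n f hf =>
    (Finset.aemeasurable_fun_sum _ fun i _ =>
      hf.comp_aemeasurable (hident i).aemeasurable_fst).const_mul _
  have hp_meas := fun n => hmean_meas n hmp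
  have hq_meas := fun n => hmean_meas n hmq
  have hr_meas := fun n => hmean_meas n hmr
  have hD_meas : ∀ n, AEMeasurable (fun ω => D (sampleMean Zs As n ω)) P := fun n => by
    simp only [hD]; fun_prop
  have hτ_meas : ∀ (n : ℕ) (a b : ℝ),
      AEMeasurable (fun ω => tversky (sampleMean Zs As n ω) a b) P := fun n a b => by
    unfold tversky; fun_prop
  have hν_meas : ∀ n, AEMeasurable (fun ω => tverskyVar (sampleMean Zs As n ω) a b) P :=
    fun n => by unfold tverskyVar; fun_prop
  have hp := tendsto_sampleMean hval hindep hident hmp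
  have hq := tendsto_sampleMean hval hindep hident hmq
  have hr := tendsto_sampleMean hval hindep hident hmr
  have hDlim : ∀ᵐ ω ∂P, Tendsto (fun n => D (sampleMean Zs As n ω)) atTop (𝓝 (D E)) := by
    filter_upwards [hp, hq, hr] with ω h1 h2 h3
    exact (h1.add (h2.const_mul a)).add (h3.const_mul b)
  have key := tendsto_real_abs_le_of_slutsky (P := P) c hCLT
    (Y := fun n ω => (D (sampleMean Zs As n ω))⁻¹)
    -- The remainder `U n` is the error of the linearization; it vanishes once `D(E_n) > 0`.
    (U := fun n ω => √n * (tversky (sampleMean Zs As n ω) a b - τ) -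
      (√n)⁻¹ * (∑ k ∈ Finset.range n, X k ω - n * 0) * (D (sampleMean Zs As n ω))⁻¹)
    (R := fun n ω => √(tverskyVar (sampleMean Zs As n ω) a b))
    (y := (D E)⁻¹) (r := √(tverskyVar E a b))
    (fun n => (hD_meas n).inv)
    (fun n => (((hτ_meas n a b).sub_const _).const_mul _).sub
      ((hCLT.forall_aemeasurable n).mul (hD_meas n).inv))
    (fun n => (hν_meas n).sqrt)
    (by filter_upwards [hDlim] with ω h using h.inv₀ hD0.ne')
    (by
      filter_upwards [hDlim] with ω h
      refine tendsto_const_nhds.congr' ?_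
      filter_upwards [h.eventually (lt_mem_nhds hD0), eventually_gt_atTop 0] with n hn hn0
      have hn0' : (0 : ℝ) < n := Nat.cast_pos.2 hn0
      have hsum : ∑ k ∈ Finset.range n, X k ω = n * (sampleMean Zs As n ω (fun z y => z * y) -
          τ * D (sampleMean Zs As n ω)) := by
        simp only [hD, sampleMean, hX, hW, Finset.sum_sub_distrib, ← Finset.mul_sum,
          Finset.sum_add_distrib]
        field_simp
      have hτn : tversky (sampleMean Zs As n ω) a b =
        sampleMean Zs As n ω (fun z y => z * y) / D (sampleMean Zs As n ω) := rfl
      rw [hsum, hτn]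
      have hs : √(n : ℝ) ≠ 0 := by positivity
      have hss : (√(n : ℝ)) ^ 2 = n := Real.sq_sqrt hn0'.le
      field_simp
      rw [hss]
      ring)
    (by
      filter_upwards [hp, hq, hr] with ω h1 h2 h3
      exact (tendsto_tverskyVar h1 h2 h3 hp0 hq0 hr0 ha hb).sqrt)
    (Real.sqrt_pos.2 hν0) (by field_simp)
  refine key.congr' ?_
  filter_upwards [eventually_gt_atTop 0] with n hn0
  have hn0' : (0 : ℝ) < √n := Real.sqrt_pos.2 (Nat.cast_pos.2 hn0)
  congr 1
  ext ω
  simp only [Set.mem_ofPred_eq, plusMinus, Set.mem_Icc]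
  -- `V n * Y n + U n` is `√n * (τ_n - τ)` by the choice of `U n`.
  rw [add_sub_cancel, abs_mul, abs_of_pos hn0', Real.sqrt_div' _ (Nat.cast_nonneg n),
    ← mul_div_assoc, ← le_div_iff₀' hn0', abs_le]
  constructor <;> rintro ⟨h1, h2⟩ <;> constructor <;> linarith

end

theorem corollary1 {Ω : Type*} [MeasurableSpace Ω] (P : Measure Ω) [IsProbabilityMeasure P]
    (Z A : Ω → ℝ) (Zs As : ℕ → Ω → ℝ)
    (hval : ∀ᵐ ω ∂P, (Z ω = 0 ∨ Z ω = 1) ∧ (A ω = 0 ∨ A ω = 1))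
    (hindep : iIndepFun (fun (i : ℕ) (ω : Ω) => (Zs i ω, As i ω)) P)
    (hident : ∀ i : ℕ,
      IdentDistrib (fun ω => (Zs i ω, As i ω)) (fun ω => (Z ω, A ω)) P P)
    (hpos : 0 < P {ω | Z ω = 1 ∧ A ω = 1})
    (hne : 0 < P {ω | Z ω ≠ A ω}) :
    (∀ a b : ℝ, 0 < a → 0 < b →
      (∀ α : ℝ, 0 < α → α < 1 →
        Tendsto (fun n : ℕ => P.real {ω | tversky (popMean P Z A) a b ∈
            plusMinus (tversky (sampleMean Zs As n ω) a b)
              (normalQuantile (1 - α / 2) *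
                Real.sqrt (tverskyVar (sampleMean Zs As n ω) a b / n))})
          atTop (𝓝 (1 - α))) ∧
      Tendsto (fun n : ℕ => P.real {ω | tversky (popMean P Z A) a b ∈
            plusMinus (tversky (sampleMean Zs As n ω) a b)
              (1.96 * Real.sqrt (tverskyVar (sampleMean Zs As n ω) a b / n))})
          atTop (𝓝 ((gaussianReal 0 1).real (Set.Icc (-1.96) 1.96)))) ∧
    (∀ β : ℝ, 0 < β →
      (∀ α : ℝ, 0 < α → α < 1 →
        Tendsto (fun n : ℕ => P.real {ω | fMeasure (popMean P Z A) β ∈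
            plusMinus (fMeasure (sampleMean Zs As n ω) β)
              (normalQuantile (1 - α / 2) *
                Real.sqrt (fMeasureVar (sampleMean Zs As n ω) β / n))})
          atTop (𝓝 (1 - α))) ∧
      Tendsto (fun n : ℕ => P.real {ω | fMeasure (popMean P Z A) β ∈
            plusMinus (fMeasure (sampleMean Zs As n ω) β)
              (1.96 * Real.sqrt (fMeasureVar (sampleMean Zs As n ω) β / n))})
          atTop (𝓝 ((gaussianReal 0 1).real (Set.Icc (-1.96) 1.96)))) ∧
    |normalQuantile (1 - 0.05 / 2) - 1.96| < 0.005 ∧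
    |(gaussianReal 0 1).real (Set.Icc (-1.96) 1.96) - 0.95| < 0.0005 := by
  have hZA := (hident 0).aemeasurable_snd
  have cover : ∀ a b : ℝ, 0 < a → 0 < b → ∀ c : ℝ, _ := fun a b ha hb c =>
    tendsto_tversky_coverage hval hindep hident hpos hne ha hb c
  have hpop : ∀ β, fMeasure (popMean P Z A) β =
      tversky (popMean P Z A) (1 / (1 + β ^ 2)) (β ^ 2 / (1 + β ^ 2)) :=
    fMeasure_eq_tversky
      ((popMean_linear hval hZA 1 1 0 rfl rfl rfl rfl).trans (by ring))
      ((popMean_linear hval hZA 1 0 1 rfl rfl rfl rfl).trans (by ring))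
  have hsample : ∀ n ω β, fMeasure (sampleMean Zs As n ω) β =
      tversky (sampleMean Zs As n ω) (1 / (1 + β ^ 2)) (β ^ 2 / (1 + β ^ 2)) := fun n ω =>
    fMeasure_eq_tversky (sampleMean_eq_add Zs As n ω fun z y => by ring)
      (sampleMean_eq_add Zs As n ω fun z y => by ring)
  refine ⟨fun a b ha hb => ⟨fun α h0 h1 => ?_, cover a b ha hb 1.96⟩,
    fun β hβ => ?_, abs_normalQuantile_sub_lt, abs_real_Icc_gaussianReal_sub_lt⟩
  · rw [← real_Icc_normalQuantile h0 h1]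
    exact cover a b ha hb _
  · simp only [hpop, hsample, fMeasureVar]
    have hb : 0 < β ^ 2 / (1 + β ^ 2) := by positivity
    refine ⟨fun α h0 h1 => ?_, cover _ _ (by positivity) hb 1.96⟩
    rw [← real_Icc_normalQuantile h0 h1]
    exact cover _ _ (by positivity) hb _
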